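/- Let $p$ be a prime, $e\ge 1$, $q=p^e$, let $t_1,\dots,t_\ell$ be square-free polynomials in one variable over $\mathbb F_q$, and let $\mathcal A=\mathbb F_q[X_1,\dots,X_\ell]/\langle t_1(X_1),\dots,t_\ell(X_\ell)\rangle$. Let $H$ be the set of tuples $\nu=(\nu_1,\dots,\nu_\ell)$ over an algebraic closure of $\mathbb F_q$ with $t_i(\nu_i)=0$ for all $i$. For $\nu\in H$ let $S(\nu)=\{(\nu_1^{q^j},\dots,\nu_\ell^{q^j}) : j\in\mathbb N\}$, let $\hat S$ be the set of these classes, and let $\mathcal N=|\hat S|$. Then $\mathcal A\cong\bigoplus_{S(\nu)\in\hat S}\mathbb F_q(\nu_1,\dots,\nu_\ell)$ by evaluation at $\nu$; let $e_{S(\nu)}$ be the corresponding primitive idempotents of $\mathcal A$. A linear code $C\subseteq\mathcal A^n$ is an $\mathcal A$-submodule; it is $\lambda$-constacyclic if it corresponds to an ideal of $\mathcal A[x]/\langle x^n-\lambda\rangle$ under $(c_0,\dots,c_{n-1})\mapsto c_0+c_1x+\dots+c_{n-1}x^{n-1}$. For $k\ge 0$ its $k$-Galois dual is $C^{\perp_k}=\{a\in\mathcal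 A^n : \sum_i a_i c_i^{p^k}=0 \text{ for all } c\in C\}$, and $\mathrm{hull}_k(C)=C\cap C^{\perp_k}$. The $q$-dimension of a linear code $D\subseteq\mathcal A^n$ is $\sum_{S(\nu)\in\hat S}\dim_{\mathbb F_q(\nu_1,\dots,\nu_\ell)} D_{S(\nu)}$, where $D_{S(\nu)}\subseteq\mathbb F_q(\nu_1,\dots,\nu_\ell)^n$ is the image of $D$ under coordinatewise evaluation at $\nu$. Let $\mathcal D_k(n,q,\lambda)$ be the set of $q$-dimensions of $\mathrm{hull}_k(C)$, where $C$ runs over all $\lambda$-constacyclic codes of length $n$ over $\mathcal A$. Let $n=n'p^{e'}$ with $\gcd(n',p)=1$ and $e'\ge 0$. Let $\lambda=\sum_{S(\nu)\in\hat S}\lambda_{S(\nu)}e_{S(\nu)}$ with $\lambda_{S(\nu)}\in\mathbb F_q$ be a unit of $\mathcal A$ of multiplicative order $\mathrm{ord}(\lambda)$. Let $0\le k<e$, and assume that $\gcd(\mathrm{ord}(\lambda),n')=1$ and $\mathrm{ord}(\lambda)\mid 1+p^{e-k}$. 1. If $p$ is odd and $n'=1$, then $|\mathcal D_k(n,q,\lambda)|=\frac{\mathcal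 N(n-1)}2+1$. 2. If $p=2$, $e$ is even, $k=\frac e2$, $e'\ge 1$ (that is, $n$ is even), and $\mathrm{ord}(\lambda)\,n'\mid 2^e-1$, then $|\mathcal D_{e/2}(n,2^e,\lambda)|=\frac{\mathcal N n}2+1$. 3. If every $t_i$ splits into linear factors over $\mathbb F_q$ (so that $\mathcal A=\bigoplus_{S(\nu)\in\hat S}\mathbb F_q e_{S(\nu)}$), then the $q$-dimension of every linear code over $\mathcal A$ is its dimension over $\mathbb F_q$, so that 1 and 2 then count the $\mathbb F_q$-dimensions of the hulls. -/

import Mathlib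

noncomputable section

open Polynomial

namespace GaloisHull

/-- The ideal `⟨t₁(X₁), …, t_ℓ(X_ℓ)⟩` of `F[X₁, …, X_ℓ]`. -/
def relIdeal {F : Type*} [Field F] {l : ℕ} (t : Fin l → F[X]) : Ideal (MvPolynomial (Fin l) F) :=
  Ideal.span (Set.range fun i => aeval (MvPolynomial.X i : MvPolynomial (Fin l) F) (t i))

/-- The code alphabet `𝒜 = F[X₁, …, X_ℓ] / ⟨t₁(X₁), …, t_ℓ(X_ℓ)⟩`. -/
abbrev Alphabet {F : Type*} [Field F] {l : ℕ} (t : Fin l → F[X]) : Type _ :=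
  MvPolynomial (Fin l) F ⧸ relIdeal t

/-- `H = H₁ × ⋯ × H_ℓ`, where `H_i` is the set of roots of `t_i` in an algebraic closure of `F`. -/
def rootTuples {F : Type*} [Field F] {l : ℕ} (t : Fin l → F[X]) :
    Set (Fin l → AlgebraicClosure F) :=
  {v | ∀ i, aeval (v i) (t i) = 0}

/-- The class `S(ν) = {(ν₁^(q^j), …, ν_ℓ^(q^j)) : j ∈ ℕ}`, with `q = |F|`. -/
def frobClass {F : Type*} [Field F] {l : ℕ} (v : Fin l → AlgebraicClosure F) :
    Set (Fin l → AlgebraicClosure F) :=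
  Set.range fun j : ℕ => fun i => v i ^ (Nat.card F ^ j)

/-- The set `Ŝ` of all classes `S(ν)`, `ν ∈ H`. -/
def classes {F : Type*} [Field F] {l : ℕ} (t : Fin l → F[X]) :
    Set (Set (Fin l → AlgebraicClosure F)) :=
  frobClass (F := F) '' rootTuples t

/-- `𝒩 = |Ŝ|`. -/
def numClasses {F : Type*} [Field F] {l : ℕ} (t : Fin l → F[X]) : ℕ := (classes t).ncard

/-- There are finitely many classes, so that `𝒩` is the true cardinality and sums over `Ŝ`
are finite. -/
theorem classes_finite {F : Type*} [Field F] {l : ℕ} (t : Fin l → F[X]) (ht : ∀ i, t i ≠ 0) :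
    (classes t).Finite := by
  refine Set.Finite.image _ (Set.Finite.subset
    (Set.Finite.pi' (t := fun i => {x | aeval x (t i) = 0}) fun i => ?_) (fun v hv => hv))
  classical
  refine ((t i).aroots (AlgebraicClosure F)).toFinset.finite_toSet.subset fun x hx => ?_
  simpa [Polynomial.mem_aroots, ht i] using hx

/-- A chosen representative `ν ∈ H` of a class in `Ŝ`. -/
def rep {F : Type*} [Field F] {l : ℕ} {t : Fin l → F[X]} (S : classes t) :
    Fin l → AlgebraicClosure F :=
  S.2.choose

theorem rep_mem {F : Type*} [Field F] {l : ℕ} {t : Fin l → F[X]} (S : classes t) :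
    rep S ∈ rootTuples t :=
  S.2.choose_spec.1

/-- The field `F(ν₁, …, ν_ℓ)`. -/
abbrev residueField {F : Type*} [Field F] {l : ℕ} (v : Fin l → AlgebraicClosure F) :
    IntermediateField F (AlgebraicClosure F) :=
  IntermediateField.adjoin F (Set.range v)

/-- Evaluation at `ν ∈ H`, the projection of `𝒜 ≅ ⨁ F(ν₁, …, ν_ℓ)` to the component of the class
`S(ν)`. -/
def evalAt {F : Type*} [Field F] {l : ℕ} {t : Fin l → F[X]} (v : Fin l → AlgebraicClosure F)
    (hv : v ∈ rootTuples t) : Alphabet t →ₐ[F] residueField v :=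
  Ideal.Quotient.liftₐ (relIdeal t)
    (MvPolynomial.aeval fun i =>
      (⟨v i, IntermediateField.subset_adjoin F _ ⟨i, rfl⟩⟩ : residueField v))
    (by
      intro a ha
      suffices h : relIdeal t ≤ RingHom.ker (MvPolynomial.aeval (R := F) fun i =>
          (⟨v i, IntermediateField.subset_adjoin F _ ⟨i, rfl⟩⟩ : residueField v)) from h ha
      refine Ideal.span_le.2 ?_
      rintro _ ⟨i, rfl⟩
      simp only [SetLike.mem_coe, RingHom.mem_ker, ← Polynomial.aeval_algHom_apply,
        MvPolynomial.aeval_X]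
      refine Subtype.val_injective ?_
      rw [← IntermediateField.coe_val, ← Polynomial.aeval_algHom_apply]
      exact hv i)

/-- A primitive idempotent of a commutative ring. -/
def IsPrimitiveIdempotent {R : Type*} [CommRing R] (e : R) : Prop :=
  IsIdempotentElem e ∧ e ≠ 0 ∧ ∀ f : R, IsIdempotentElem f → f * e = f → f = 0 ∨ f = e

/-- The linear code `C ⊆ Rⁿ` is `lam`-constacyclic: under `c ↦ c₀ + c₁ x + ⋯ + c_{n-1} x^{n-1}` it
is identified with an ideal of `R[x] / ⟨xⁿ - lam⟩`. -/
def IsConstacyclic {R : Type*} [CommRing R] {n : ℕ} (lam : R) (C : Submodule R (Fin n → R)) :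
    Prop :=
  ∃ I : Ideal (R[X] ⧸ Ideal.span {(X : R[X]) ^ n - Polynomial.C lam}), ∀ c : Fin n → R,
    c ∈ C ↔ Ideal.Quotient.mk _ (∑ i : Fin n, Polynomial.C (c i) * X ^ (i : ℕ)) ∈ I

/-- The `k`-Galois dual `C^{⊥_k} = {a ∈ Rⁿ : ∑ a_i c_i^{p^k} = 0 for all c ∈ C}`. -/
def galoisDual {R : Type*} [CommRing R] {n : ℕ} (p k : ℕ) (C : Submodule R (Fin n → R)) :
    Submodule R (Fin n → R) where
  carrier := {a | ∀ c ∈ C, ∑ i, a i * c i ^ p ^ k = 0}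
  add_mem' := by
    intro a b ha hb c hc
    simp only [Pi.add_apply, add_mul, Finset.sum_add_distrib, ha c hc, hb c hc, add_zero]
  zero_mem' := by
    intro c _
    simp
  smul_mem' := by
    intro r a ha c hc
    simp only [Pi.smul_apply, smul_eq_mul, mul_assoc, ← Finset.mul_sum, ha c hc, mul_zero]

/-- The `k`-Galois hull `C ∩ C^{⊥_k}`. -/
def galoisHull {R : Type*} [CommRing R] {n : ℕ} (p k : ℕ) (C : Submodule R (Fin n → R)) :
    Submodule R (Fin n → R) :=
  C ⊓ galoisDual p k C

/-- The projection `C_{S(ν)} ⊆ F(ν)ⁿ` of a linear code over `𝒜`. The image of `C` is closed under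
the operations already, so that taking the span adds nothing. -/
def component {F : Type*} [Field F] {l : ℕ} {t : Fin l → F[X]} {n : ℕ}
    (C : Submodule (Alphabet t) (Fin n → Alphabet t)) (S : classes t) :
    Submodule (residueField (rep S)) (Fin n → residueField (rep S)) :=
  Submodule.span _ ((fun c i => evalAt (rep S) (rep_mem S) (c i)) '' (C : Set (Fin n → Alphabet t)))

/-- The `q`-dimension of a linear code over `𝒜`: the sum of the dimensions of its components. It is
the dimension over `F` if all components of `𝒜` are copies of `F`. -/
def qDim {F : Type*} [Field F] {l : ℕ} {t : Fin l → F[X]} {n : ℕ}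
    (C : Submodule (Alphabet t) (Fin n → Alphabet t)) : ℕ :=
  ∑ᶠ S : classes t, Module.finrank (residueField (rep S)) (component C S)

/-- `𝒟_k(n, q, lam)`: the set of `q`-dimensions of `k`-Galois hulls of `lam`-constacyclic codes of
length `n` over `𝒜`. -/
def hullDims {F : Type*} [Field F] {l : ℕ} (t : Fin l → F[X]) (p k n : ℕ) (lam : Alphabet t) :
    Set ℕ :=
  {d | ∃ C : Submodule (Alphabet t) (Fin n → Alphabet t),
    IsConstacyclic lam C ∧ qDim (galoisHull p k C) = d}

end GaloisHull

end

noncomputable section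

open Polynomial

namespace GaloisHull

/-! Write `σ` for the `p^k`-th power map. Evaluation at the classes identifies `𝒜` with a product of
finite fields, so codes, the form `∑ aᵢ σ(cᵢ)` and hulls can be studied one component at a time. A
component of a hull is self-orthogonal, hence has dimension at most `⌊n/2⌋`, and every `q`-dimension
is at most `𝒩⌊n/2⌋`. All values up to this bound occur as soon as each component field carries
self-orthogonal constacyclic codes of every dimension up to `⌊n/2⌋`: glue these freely, and the
glued code is its own hull (`hullDims_eq_Iic`).

To construct them, let `T` be the constacyclic shift over a field. The order condition gives `λ σ(λ)
= 1`, so `T` is an isometry of the form. If `xⁿ - λ = (x^m - μ)^(p^a)`, then `μ σ(μ) = 1` as well,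
and `N = T^m - μ` is its own adjoint up to the invertible operator `T^m` and a scalar. As `N^(2j) =
0` for `2j ≥ p^a`, the image of `N^j` is self-orthogonal, of dimension at least `n - mj`
(`exists_selfOrthogonal_constashift`). Since `xⁿ - λ` splits, `T` can be triangularized and this
image contains invariant subspaces of all smaller dimensions. For odd `p` and `n' = 1` take `m = 1`,
`j = (n+1)/2`; for `p = 2` and `n` even take `m = n/2`, `j = 1`. -/

/-- The multiplication by `x` on `R[x] / ⟨xⁿ⁺¹ - lam⟩`, in coordinates. -/
def constashift {R : Type*} [CommRing R] {n : ℕ} (lam : R) : Module.End R (Fin (n + 1) → R) where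
  toFun c := Fin.cons (lam * c (Fin.last n)) fun i => c i.castSucc
  map_add' a b := by
    ext i
    refine Fin.cases ?_ (fun i => ?_) i <;> simp [mul_add]
  map_smul' r a := by
    ext i
    refine Fin.cases ?_ (fun i => ?_) i <;> simp [mul_left_comm]

/-! ### The constacyclic shift and the quotient `R[x] / ⟨xⁿ - lam⟩`. -/

section Shift

variable {R : Type*} [CommRing R] {n : ℕ} (lam : R)

@[simp] theorem constashift_zero (c : Fin (n + 1) → R) :
    constashift lam c 0 = lam * c (Fin.last n) := rfl

@[simp] theorem constashift_succ (c : Fin (n + 1) → R) (i : Fin n) :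
    constashift lam c i.succ = c i.castSucc := rfl

/-- The class of `c₀ + c₁ x + ⋯` in `R[x] / ⟨xⁿ - lam⟩`. -/
def toQuotient (n : ℕ) : (Fin n → R) →ₗ[R] R[X] ⧸ Ideal.span {(X : R[X]) ^ n - C lam} where
  toFun c := Ideal.Quotient.mk _ (∑ i : Fin n, C (c i) * X ^ (i : ℕ))
  map_add' a b := by
    simp [add_mul, Finset.sum_add_distrib]
  map_smul' r a := by
    rw [← Ideal.Quotient.mkₐ_eq_mk R, RingHom.id_apply, ← map_smul]
    simp [Finset.smul_sum, smul_eq_C_mul, mul_assoc]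

theorem toQuotient_apply (c : Fin n → R) :
    toQuotient lam n c = Ideal.Quotient.mk _ (∑ i : Fin n, C (c i) * X ^ (i : ℕ)) := rfl

theorem smul_toQuotient (r : R) (c : Fin n → R) :
    r • toQuotient lam n c = Ideal.Quotient.mk _ (C r) * toQuotient lam n c := by
  rw [toQuotient_apply, ← map_mul, ← smul_eq_C_mul]
  rfl

theorem toQuotient_constashift (c : Fin (n + 1) → R) :
    toQuotient lam (n + 1) (constashift lam c) =
      Ideal.Quotient.mk _ X * toQuotient lam (n + 1) c := by
  rw [toQuotient_apply, toQuotient_apply, ← map_mul, Ideal.Quotient.eq]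
  rw [Fin.sum_univ_succ, Fin.sum_univ_castSucc (n := n) (f := fun i => C (c i) * X ^ (i : ℕ))]
  refine Ideal.mem_span_singleton.2 ⟨- C (c (Fin.last n)), ?_⟩
  simp only [constashift_zero, constashift_succ, Fin.val_zero, Fin.val_succ, mul_add,
    Finset.mul_sum, Fin.val_castSucc, Fin.val_last, map_mul]
  rw [Finset.sum_congr rfl fun (i : Fin n) _ =>
    (by ring : C (c i.castSucc) * (X : R[X]) ^ ((i : ℕ) + 1) = X * (C (c i.castSucc) * X ^ (i : ℕ)))]
  ring

theorem eq_zero_of_mk_eq_zero [Nontrivial R] (hn : n ≠ 0) {f : R[X]} (hf : f.degree < n)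
    (h : Ideal.Quotient.mk (Ideal.span {(X : R[X]) ^ n - C lam}) f = 0) : f = 0 := by
  rw [Ideal.Quotient.eq_zero_iff_mem, Ideal.mem_span_singleton] at h
  by_contra hf0
  refine (monic_X_pow_sub_C lam hn).not_dvd_of_degree_lt hf0 ?_ h
  rwa [degree_X_pow_sub_C (Nat.pos_of_ne_zero hn)]

theorem toQuotient_injective (hn : n ≠ 0) : Function.Injective (toQuotient lam n) := by
  nontriviality R
  refine (injective_iff_map_eq_zero _).2 fun c hc => funext fun i => ?_
  have h := eq_zero_of_mk_eq_zero lam hn (degree_sum_fin_lt c) hc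
  have := congrArg (coeff · (i : ℕ)) h
  simpa [finsetSum_coeff, coeff_C_mul, coeff_X_pow, Fin.val_inj] using this

theorem toQuotient_aeval (f : R[X]) (c : Fin (n + 1) → R) :
    toQuotient lam (n + 1) (aeval (constashift lam) f c) =
      Ideal.Quotient.mk _ f * toQuotient lam (n + 1) c := by
  induction f using Polynomial.induction_on' with
  | add f g hf hg => simp [add_mul, hf, hg]
  | monomial k r =>
    induction k with
    | zero =>
      rw [monomial_zero_left, aeval_C, Module.algebraMap_end_apply, map_smul, smul_toQuotient]
    | succ k ih =>
      rw [← X_mul_monomial, map_mul, Module.End.mul_apply, aeval_X, toQuotient_constashift, ih,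
        map_mul, mul_assoc]

theorem isConstacyclic_of_constashift_mem {C : Submodule R (Fin (n + 1) → R)}
    (h : ∀ c ∈ C, constashift lam c ∈ C) : IsConstacyclic lam C := by
  have key (f : R[X]) : ∀ c ∈ C, aeval (constashift lam) f c ∈ C := by
    induction f using Polynomial.induction_on' with
    | add f g hf hg => exact fun c hc => by simpa using C.add_mem (hf c hc) (hg c hc)
    | monomial k r =>
      intro c hc
      rw [aeval_monomial, Module.End.mul_apply, Module.algebraMap_end_apply]
      refine C.smul_mem _ ?_
      induction k with
      | zero => simpa
      | succ k ih => rw [pow_succ', Module.End.mul_apply]; exact h _ ih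
  refine ⟨{ toAddSubmonoid := (C.map (toQuotient lam (n + 1))).toAddSubmonoid, smul_mem' := ?_ },
    fun c => ?_⟩
  · rintro z _ ⟨c, hc, rfl⟩
    obtain ⟨f, rfl⟩ := Ideal.Quotient.mk_surjective z
    exact ⟨_, key f c hc, toQuotient_aeval lam f c⟩
  · refine ⟨fun hc => ⟨c, hc, rfl⟩, ?_⟩
    rintro ⟨c', hc', h'⟩
    rwa [← toQuotient_injective lam n.succ_ne_zero h']

theorem constashift_pow : constashift (n := n) lam ^ (n + 1) = algebraMap R _ lam := by
  refine LinearMap.ext fun c => toQuotient_injective lam n.succ_ne_zero ?_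
  have h := toQuotient_aeval lam (X ^ (n + 1)) c
  rw [map_pow, aeval_X] at h
  rw [h, Module.algebraMap_end_apply, map_smul, smul_toQuotient]
  congr 1
  exact Ideal.Quotient.eq.2 (Ideal.mem_span_singleton_self _)

/-- The shift permutes the terms of the form cyclically; only the wrapped-around term changes, by
the factor `lam * σ lam`. -/
theorem constashift_pair (σ : R →+* R) (hl : lam * σ lam = 1) (a c : Fin (n + 1) → R) :
    ∑ i, constashift lam a i * σ (constashift lam c i) = ∑ i, a i * σ (c i) := by
  rw [Fin.sum_univ_succ, Fin.sum_univ_castSucc (n := n) (f := fun i => a i * σ (c i))]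
  simp only [constashift_zero, constashift_succ, map_mul]
  linear_combination a (Fin.last n) * σ (c (Fin.last n)) * hl

end Shift

/-! ### Self-orthogonal constacyclic codes over a field. -/

section Field

variable {K : Type*} [Field K] {n : ℕ}

/-- A generator matrix `M` satisfies `M σ(M)ᵀ = 0`, and both `M` and `σ(M)` have rank `dim D`, since
a bijective `σ` preserves independence of rows. -/
theorem two_mul_finrank_le_of_selfOrthogonal (σ : K →+* K) (hσ : Function.Surjective σ)
    (D : Submodule K (Fin n → K)) (hD : ∀ a ∈ D, ∀ c ∈ D, ∑ i, a i * σ (c i) = 0) :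
    2 * Module.finrank K D ≤ n := by
  let b := Module.finBasis K D
  let M : Matrix (Fin (Module.finrank K D)) (Fin n) K := Matrix.of fun i => (b i : Fin n → K)
  have hM : LinearIndependent K M.row := b.linearIndependent.map' D.subtype D.ker_subtype
  let φ : (Fin n → K) →+ (Fin n → K) :=
    AddMonoidHom.mk' (fun v i => σ (v i)) fun a b => by ext; simp
  have hM' : LinearIndependent K (φ ∘ M.row) :=
    hM.map_of_surjective_injective σ φ hσ
      (fun m hm => funext fun i => by simpa [φ] using congrFun hm i)
      (fun r m => by ext; simp [φ])
  replace hM' : LinearIndependent K (M.map σ).row := hM'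
  have h0 : M * (M.map σ).transpose = 0 := by
    ext i j
    rw [Matrix.mul_apply]
    exact hD _ (b i).2 _ (b j).2
  have := Matrix.rank_add_rank_le_card_of_mul_eq_zero h0
  rw [Matrix.rank_transpose, hM.rank_matrix, hM'.rank_matrix] at this
  simpa [two_mul] using this

/-- An endomorphism annihilated by a split polynomial has an invariant subspace of every dimension
inside any invariant subspace. -/
theorem exists_invariant_finrank_eq {V : Type*} [AddCommGroup V] [Module K V]
    [FiniteDimensional K V] (T : Module.End K V) {f : K[X]} (hf0 : f ≠ 0) (hf : f.Splits)
    (hT : aeval T f = 0) (d : ℕ) (W : Submodule K V) (hW : ∀ w ∈ W, T w ∈ W)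
    (hd : d ≤ Module.finrank K W) :
    ∃ U ≤ W, (∀ u ∈ U, T u ∈ U) ∧ Module.finrank K U = d := by
  induction hr : Module.finrank K W - d generalizing W with
  | zero => exact ⟨W, le_rfl, hW, by omega⟩
  | succ r ih =>
    have : Nontrivial W := Module.finrank_pos_iff.1 (by omega : 0 < Module.finrank K W)
    let S : Module.End K W := T.restrict hW
    have hS : aeval S f = 0 := by
      ext w
      have key (g : K[X]) (w : W) : (aeval S g w : V) = aeval T g w := by
        induction g using Polynomial.induction_on generalizing w with
        | C a => simp
        | add g h hg hh => simp [hg, hh]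
        | monomial k a ih =>
          rw [pow_succ, ← mul_assoc, map_mul (aeval S), map_mul (aeval T), Module.End.mul_apply,
            Module.End.mul_apply, ih, aeval_X, aeval_X]
          rfl
      rw [key, hT]; rfl
    have hint := Algebra.IsIntegral.isIntegral (R := K) S
    have hs : (minpoly K S).Splits := hf.of_dvd hf0 (minpoly.dvd K S hS)
    obtain ⟨a, ha⟩ := hs.exists_eval_eq_zero (minpoly.degree_pos hint).ne'
    have hev : S.HasEigenvalue a := Module.End.hasEigenvalue_of_isRoot ha
    have hlt : LinearMap.range (S - algebraMap K _ a) < ⊤ := by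
      refine lt_top_iff_ne_top.2 fun h => ?_
      have h1 := LinearMap.ker_eq_bot.2 (LinearMap.injective_iff_surjective.2
        (LinearMap.range_eq_top.1 h))
      exact hev (Module.End.eigenspace_def.trans h1)
    -- On a hyperplane of `W` containing the image of `S - a`, `S u = (S - a) u + a u` stays inside,
    -- so the dimension can be lowered by exactly one.
    obtain ⟨φ, hφ, hUr⟩ := Submodule.exists_le_ker_of_lt_top _ hlt
    let U : Submodule K W := LinearMap.ker φ
    have hUS : ∀ u ∈ U, S u ∈ U := fun u hu => by
      have h1 : (S - algebraMap K _ a) u ∈ U := hUr ⟨u, rfl⟩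
      have h2 := U.add_mem h1 (U.smul_mem a hu)
      simpa using h2
    have hfr : Module.finrank K U + 1 = Module.finrank K W :=
      Module.Dual.finrank_ker_add_one_of_ne_zero hφ
    have hfm : Module.finrank K (U.map W.subtype) = Module.finrank K U :=
      (Submodule.equivMapOfInjective _ W.injective_subtype U).finrank_eq.symm
    obtain ⟨U', h1, h2, h3⟩ := ih (U.map W.subtype) (by
        rintro _ ⟨u, hu, rfl⟩
        exact ⟨S u, hUS u hu, rfl⟩)
      (by omega) (by omega)
    exact ⟨U', h1.trans (Submodule.map_subtype_le _ _), h2, h3⟩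

/-- Multiples `u g` of degree below `n + 1` are nonzero modulo `x^(n+1) - lam`, so such `g` embed
into the range via `g ↦ u(T) g(T) e₀`, where `e₀` corresponds to `1`. -/
theorem le_finrank_range_aeval_constashift (lam : K) {u : K[X]} (hu : u ≠ 0) :
    n + 1 - u.natDegree ≤
      Module.finrank K (LinearMap.range (aeval (constashift (n := n) lam) u)) := by
  let T := constashift (n := n) lam
  let e₀ : Fin (n + 1) → K := Pi.single 0 1
  have he : toQuotient lam (n + 1) e₀ = 1 := by
    rw [toQuotient_apply, Finset.sum_eq_single 0] <;> simp +contextual [e₀]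
  let ψ : degreeLT K (n + 1 - u.natDegree) →ₗ[K] LinearMap.range (aeval T u) :=
    { toFun g := ⟨aeval T u (aeval T (g : K[X]) e₀), ⟨_, rfl⟩⟩
      map_add' a b := by ext; simp
      map_smul' a b := by ext; simp }
  have hψ : Function.Injective ψ := by
    refine (injective_iff_map_eq_zero _).2 fun g hg => Subtype.ext ?_
    have h1 : aeval T (u * (g : K[X])) e₀ = 0 := by
      rw [map_mul]
      exact congrArg Subtype.val hg
    have h2 := toQuotient_aeval lam (u * (g : K[X])) e₀
    rw [h1, map_zero, he, mul_one] at h2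
    by_contra hg0
    refine mul_ne_zero hu hg0 (eq_zero_of_mk_eq_zero lam n.succ_ne_zero ?_ h2.symm)
    have h3 := mem_degreeLT.1 g.2
    rw [degree_eq_natDegree hg0, Nat.cast_lt] at h3
    rw [degree_mul, degree_eq_natDegree hg0, degree_eq_natDegree hu, ← Nat.cast_add, Nat.cast_lt]
    omega
  have := LinearMap.finrank_le_finrank_of_injective hψ
  rwa [(degreeLTEquiv K _).finrank_eq, Module.finrank_fin_fun] at this

theorem constashift_pow_pair (lam : K) (σ : K →+* K) (hl : lam * σ lam = 1) (m : ℕ)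
    (a c : Fin (n + 1) → K) :
    ∑ i, (constashift lam ^ m) a i * σ ((constashift lam ^ m) c i) = ∑ i, a i * σ (c i) := by
  induction m with
  | zero => simp
  | succ m ih =>
    rw [pow_succ', Module.End.mul_apply, Module.End.mul_apply, constashift_pair lam σ hl, ih]

/-- The adjoint of the isometry `T^m` is `T^(-m)`, and `T^(-m) - σ(mu) = -σ(mu) T^(-m) (T^m - mu)`
because `mu * σ mu = 1`. Stated with `T^m` on the left to avoid inverses. -/
theorem constashift_pow_pair_sub (lam mu : K) (σ : K →+* K) (hl : lam * σ lam = 1)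
    (hmu : mu * σ mu = 1) (m : ℕ) {N : Module.End K (Fin (n + 1) → K)}
    (hN : N = constashift lam ^ m - algebraMap K _ mu) (a c : Fin (n + 1) → K) :
    ∑ i, (constashift lam ^ m) a i * σ (N c i) = - σ mu * ∑ i, N a i * σ (c i) := by
  have h := constashift_pow_pair lam σ hl m a c
  have h1 (x i) : N x i = (constashift lam ^ m) x i - mu * x i := by simp [hN]
  simp only [h1, map_sub, map_mul, mul_sub, sub_mul, Finset.sum_sub_distrib, h, Finset.mul_sum]
  rw [Finset.sum_congr rfl fun i _ => (by linear_combination (- (a i * σ (c i))) * hmu :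
    - σ mu * (mu * a i * σ (c i)) = - (a i * σ (c i))), Finset.sum_neg_distrib,
    Finset.sum_congr rfl fun i _ => (by ring : (constashift lam ^ m) a i * (σ mu * σ (c i)) =
      - (- σ mu * ((constashift lam ^ m) a i * σ (c i)))), Finset.sum_neg_distrib]
  ring

theorem constashift_pow_pair_sub_pow (lam mu : K) (σ : K →+* K) (hl : lam * σ lam = 1)
    (hmu : mu * σ mu = 1) (m j : ℕ) {N : Module.End K (Fin (n + 1) → K)}
    (hN : N = constashift lam ^ m - algebraMap K _ mu) (a c : Fin (n + 1) → K) :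
    ∑ i, (constashift lam ^ (m * j)) a i * σ ((N ^ j) c i) =
      (- σ mu) ^ j * ∑ i, (N ^ j) a i * σ (c i) := by
  have hcomm : Commute (constashift lam) N := by
    rw [hN]
    exact ((Commute.refl _).pow_right m).sub_right (Algebra.commutes _ _).symm
  induction j generalizing a with
  | zero => simp
  | succ j ih =>
    rw [mul_add, mul_one, add_comm (m * j), pow_add, Module.End.mul_apply, pow_succ' N,
      Module.End.mul_apply, constashift_pow_pair_sub lam mu σ hl hmu m hN,
      ← Module.End.mul_apply, ← (hcomm.pow_left _).eq, Module.End.mul_apply, ih,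
      ← Module.End.mul_apply, ← pow_succ, ← pow_succ', ← mul_assoc, ← pow_succ']

/-- Self-orthogonal constacyclic codes of every dimension up to `n - m j`, when
`(x^m - mu)^(2j)` vanishes modulo `x^n - lam`. -/
theorem exists_selfOrthogonal_constashift (lam mu : K) (σ : K →+* K) (hl : lam * σ lam = 1)
    (hmu : mu * σ mu = 1) (m j : ℕ) (hm : m ≠ 0)
    (hj : (X ^ (n + 1) - C lam : K[X]) ∣ (X ^ m - C mu) ^ (2 * j))
    (hsp : (X ^ (n + 1) - C lam : K[X]).Splits) (d : ℕ) (hd : d ≤ n + 1 - m * j) :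
    ∃ D : Submodule K (Fin (n + 1) → K), (∀ c ∈ D, constashift lam c ∈ D) ∧
      (∀ a ∈ D, ∀ c ∈ D, ∑ i, a i * σ (c i) = 0) ∧ Module.finrank K D = d := by
  let T := constashift (n := n) lam
  let N := T ^ m - algebraMap K _ mu
  have hT : aeval T (X ^ (n + 1) - C lam : K[X]) = 0 := by
    simp [T, constashift_pow]
  have hNT : aeval T (X ^ m - C mu : K[X]) = N := by simp [N]
  have hN0 : N ^ (2 * j) = 0 := by
    obtain ⟨g, hg⟩ := hj
    rw [← hNT, ← map_pow, hg, map_mul, hT, zero_mul]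
  have hcomm : Commute T N :=
    ((Commute.refl _).pow_right m).sub_right (Algebra.commutes _ _).symm
  have hu : IsUnit T := by
    rw [← isUnit_pow_iff n.succ_ne_zero, constashift_pow]
    exact (left_ne_zero_of_mul_eq_one hl).isUnit.map _
  have hd' : d ≤ Module.finrank K (LinearMap.range (N ^ j)) := by
    refine hd.trans ?_
    have := le_finrank_range_aeval_constashift (n := n) lam
      (pow_ne_zero j (X_pow_sub_C_ne_zero (Nat.pos_of_ne_zero hm) mu))
    rwa [natDegree_pow, natDegree_X_pow_sub_C, map_pow, hNT, mul_comm] at this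
  obtain ⟨D, hD, hDT, hDd⟩ := exists_invariant_finrank_eq T
    (X_pow_sub_C_ne_zero n.succ_pos lam) hsp hT d (LinearMap.range (N ^ j)) (by
      rintro _ ⟨w, rfl⟩
      exact ⟨T w, by rw [← Module.End.mul_apply, ← Module.End.mul_apply,
        (hcomm.pow_right j).eq]⟩) hd'
  refine ⟨D, hDT, fun a ha c hc => ?_, hDd⟩
  obtain ⟨a, rfl⟩ := hD ha
  obtain ⟨c, rfl⟩ := hD hc
  -- The adjoint identity needs a factor `T^(m j)` on the left; `T` is invertible because `T^(n+1) =
  -- lam`. The pairing then contains `N^(2 j) b = 0`.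
  obtain ⟨b, rfl⟩ := ((Module.End.isUnit_iff _).1 (hu.pow (m * j))).2 a
  rw [← Module.End.mul_apply, ← ((hcomm.pow_left (m * j)).pow_right j).eq, Module.End.mul_apply,
    constashift_pow_pair_sub_pow lam mu σ hl hmu m j rfl, ← Module.End.mul_apply (N ^ j),
    ← pow_add, ← two_mul, hN0]
  simp

end Field

/-! ### The decomposition of the alphabet into residue fields. -/

section Alphabet

variable {F : Type*} [Field F] {l : ℕ} {t : Fin l → F[X]}

theorem evalAt_mk_X (v : Fin l → AlgebraicClosure F) (hv : v ∈ rootTuples t) (i : Fin l) :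
    (evalAt v hv (Ideal.Quotient.mk _ (MvPolynomial.X i)) : AlgebraicClosure F) = v i := by
  change ((MvPolynomial.aeval (R := F) fun i =>
    (⟨v i, IntermediateField.subset_adjoin F _ ⟨i, rfl⟩⟩ : residueField v)) (MvPolynomial.X i) :
      AlgebraicClosure F) = v i
  rw [MvPolynomial.aeval_X]

theorem alphabet_algHom_ext {B : Type*} [CommRing B] [Algebra F B] {f g : Alphabet t →ₐ[F] B}
    (h : ∀ i, f (Ideal.Quotient.mk _ (MvPolynomial.X i)) =
      g (Ideal.Quotient.mk _ (MvPolynomial.X i))) : f = g := by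
  refine Ideal.Quotient.algHom_ext _ (MvPolynomial.algHom_ext fun i => h i)

theorem aeval_mk_X_eq_zero (i : Fin l) :
    aeval (Ideal.Quotient.mk (relIdeal t) (MvPolynomial.X i)) (t i) = 0 := by
  rw [← Ideal.Quotient.mkₐ_eq_mk F, aeval_algHom_apply, Ideal.Quotient.mkₐ_eq_mk]
  exact Ideal.Quotient.eq_zero_iff_mem.2 (Ideal.subset_span ⟨i, rfl⟩)

theorem evalAt_surjective (v : Fin l → AlgebraicClosure F) (hv : v ∈ rootTuples t) :
    Function.Surjective (evalAt v hv) := by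
  have h : (residueField v).toSubalgebra ≤ ((residueField v).val.comp (evalAt v hv)).range := by
    rw [IntermediateField.adjoin_toSubalgebra_of_isAlgebraic
      fun x _ => Algebra.IsAlgebraic.isAlgebraic x, Algebra.adjoin_le_iff]
    rintro _ ⟨i, rfl⟩
    exact ⟨_, evalAt_mk_X v hv i⟩
  intro x
  obtain ⟨a, ha⟩ := h x.2
  exact ⟨a, Subtype.ext ha⟩

instance finiteDimensional_residueField (v : Fin l → AlgebraicClosure F) :
    FiniteDimensional F (residueField v) :=
  IntermediateField.finiteDimensional_adjoin fun x _ => Algebra.IsIntegral.isIntegral x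

theorem mem_frobClass_self (v : Fin l → AlgebraicClosure F) : v ∈ frobClass (F := F) v :=
  ⟨0, by simp⟩

theorem frobClass_rep (S : classes t) : frobClass (F := F) (rep S) = S := S.2.choose_spec.2

theorem frobClass_subset_of_mem {v w : Fin l → AlgebraicClosure F}
    (h : w ∈ frobClass (F := F) v) : frobClass (F := F) w ⊆ frobClass (F := F) v := by
  obtain ⟨j, rfl⟩ := h
  rintro _ ⟨k, rfl⟩
  exact ⟨j + k, funext fun i => by simp only [pow_add, pow_mul]⟩

theorem dvd_X_pow_card_sub_X [Finite F] {E : Type*} [Field E] [Finite E] [Algebra F E] {f : F[X]}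
    (hf : Squarefree f) (hs : (f.map (algebraMap F E)).Splits) : f ∣ X ^ Nat.card E - X := by
  have := Fintype.ofFinite E
  rw [← map_dvd_map' (algebraMap F E)]
  refine hs.dvd_of_roots_le_roots (map_ne_zero hf.ne_zero) ?_
  have hsep : (f.map (algebraMap F E)).Separable :=
    (PerfectField.separable_iff_squarefree.2 hf).map
  refine (Multiset.le_iff_subset (nodup_roots hsep)).2 fun x _ => ?_
  rw [Polynomial.map_sub, Polynomial.map_pow, map_X, Nat.card_eq_fintype_card,
    mem_roots (FiniteField.X_pow_card_sub_X_ne_zero E Fintype.one_lt_card)]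
  simp [FiniteField.pow_card]

/-- A square-free polynomial over a finite field `F` divides `x^(q^m) - x` for some `m ≠ 0`,
uniformly in finitely many polynomials. -/
theorem exists_forall_dvd_X_pow_card_pow_sub_X [Finite F] (ht : ∀ i, Squarefree (t i)) :
    ∃ m ≠ 0, ∀ i, t i ∣ X ^ (Nat.card F ^ m) - X := by
  have hfin : Finite (SplittingField (∏ i, t i)) := Module.finite_of_finite F
  have h0 : ∏ i, t i ≠ 0 := Finset.prod_ne_zero_iff.2 fun i _ => (ht i).ne_zero
  refine ⟨Module.finrank F (SplittingField (∏ i, t i)), Module.finrank_pos.ne', fun i => ?_⟩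
  rw [← Module.natCard_eq_pow_finrank]
  refine dvd_X_pow_card_sub_X (ht i) ((SplittingField.splits (∏ i, t i)).of_dvd (map_ne_zero h0) ?_)
  exact Polynomial.map_dvd _ (Finset.dvd_prod_of_mem _ (Finset.mem_univ i))

/-- An iterate of Frobenius is an `F`-algebra map fixing the generators. This makes `𝒜` reduced and
integral over `F`. -/
theorem exists_forall_pow_eq_self [Finite F] (ht : ∀ i, Squarefree (t i)) :
    ∃ m ≠ 0, ∀ a : Alphabet t, a ^ (Nat.card F ^ m) = a := by
  obtain ⟨m, hm, h⟩ := exists_forall_dvd_X_pow_card_pow_sub_X ht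
  have := Fintype.ofFinite F
  refine ⟨m, hm, fun a => ?_⟩
  have hpow (b : Alphabet t) :
      (FiniteField.frobeniusAlgHom F (Alphabet t) ^ m) b = b ^ (Nat.card F ^ m) := by
    rw [AlgHom.coe_pow, FiniteField.coe_frobeniusAlgHom, pow_iterate, Nat.card_eq_fintype_card]
  have key : FiniteField.frobeniusAlgHom F (Alphabet t) ^ m = AlgHom.id F _ := by
    refine alphabet_algHom_ext fun i => ?_
    rw [hpow, AlgHom.id_apply]
    obtain ⟨g, hg⟩ := h i
    have := congrArg (aeval (Ideal.Quotient.mk (relIdeal t) (MvPolynomial.X i))) hg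
    rw [map_mul, aeval_mk_X_eq_zero, zero_mul] at this
    simpa [sub_eq_zero] using this
  rw [← hpow, key, AlgHom.id_apply]

theorem exists_class_of_algHom [Finite F] (g : Alphabet t →ₐ[F] AlgebraicClosure F) :
    ∃ (S : classes t) (j : ℕ), ∀ a,
      g a = (evalAt (rep S) (rep_mem S) a : AlgebraicClosure F) ^ (Nat.card F ^ j) := by
  have := Fintype.ofFinite F
  let v : Fin l → AlgebraicClosure F := fun i => g (Ideal.Quotient.mk _ (MvPolynomial.X i))
  have hv : v ∈ rootTuples t := fun i => by
    rw [aeval_algHom_apply, aeval_mk_X_eq_zero, map_zero]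
  let S : classes t := ⟨frobClass (F := F) v, v, hv, rfl⟩
  have h1 : v ∈ frobClass (F := F) (rep S) := by
    rw [frobClass_rep S]
    exact mem_frobClass_self v
  obtain ⟨j, hj⟩ := h1
  have hpow (b : AlgebraicClosure F) :
      (FiniteField.frobeniusAlgHom F (AlgebraicClosure F) ^ j) b = b ^ (Nat.card F ^ j) := by
    rw [AlgHom.coe_pow, FiniteField.coe_frobeniusAlgHom, pow_iterate, Nat.card_eq_fintype_card]
  refine ⟨S, j, fun a => ?_⟩
  have key : g = (FiniteField.frobeniusAlgHom F (AlgebraicClosure F) ^ j).comp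
      ((residueField (rep S)).val.comp (evalAt (rep S) (rep_mem S))) := by
    refine alphabet_algHom_ext fun i => ?_
    rw [AlgHom.comp_apply, hpow, AlgHom.comp_apply, IntermediateField.coe_val, evalAt_mk_X]
    exact (congrFun hj i).symm
  conv_lhs => rw [key, AlgHom.comp_apply, hpow]
  rfl

theorem exists_injective_algHom (B : Type*) [CommRing B] [IsDomain B] [Algebra F B]
    [Algebra.IsIntegral F B] :
    ∃ g : B →ₐ[F] AlgebraicClosure F, Function.Injective g := by
  let : Field B := (isField_of_isIntegral_of_isField' (R := F) (Field.toIsField F)).toField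
  let g : B →ₐ[F] AlgebraicClosure F := IsAlgClosed.lift
  exact ⟨g, g.toRingHom.injective⟩

/-- Since `a` is not nilpotent, some prime `P` misses it; `𝒜/P` is an integral domain extension of
`F`, which embeds into the closure. -/
theorem exists_algHom_ne_zero [Finite F] (ht : ∀ i, Squarefree (t i)) {a : Alphabet t}
    (ha : a ≠ 0) : ∃ g : Alphabet t →ₐ[F] AlgebraicClosure F, g a ≠ 0 := by
  obtain ⟨m, hm, h⟩ := exists_forall_pow_eq_self ht
  have hq : 1 < Nat.card F ^ m := Nat.one_lt_pow hm Finite.one_lt_card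
  have hnil : a ∉ nilradical (Alphabet t) := by
    rintro ⟨k, hk⟩
    have hpow (j : ℕ) : a ^ ((Nat.card F ^ m) ^ j) = a := by
      induction j with
      | zero => simp
      | succ j ih => rw [pow_succ, pow_mul, ih, h]
    refine ha ?_
    rw [← hpow k]
    exact pow_eq_zero_of_le (Nat.lt_pow_self hq).le hk
  rw [nilradical_eq_sInf, Ideal.mem_sInf] at hnil
  push Not at hnil
  obtain ⟨P, hP, haP⟩ := hnil
  have hP : P.IsPrime := hP
  have hint : Algebra.IsIntegral F (Alphabet t ⧸ P) := ⟨fun x => by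
    refine ⟨X ^ (Nat.card F ^ m) - X, monic_X_pow_sub (by rwa [degree_X, Nat.one_lt_cast]), ?_⟩
    obtain ⟨b, rfl⟩ := Ideal.Quotient.mk_surjective x
    simp [← map_pow, h]⟩
  obtain ⟨g, hg⟩ := exists_injective_algHom (F := F) (Alphabet t ⧸ P)
  refine ⟨g.comp (Ideal.Quotient.mkₐ F P), fun h0 => haP ?_⟩
  exact Ideal.Quotient.eq_zero_iff_mem.1 ((map_eq_zero_iff g hg).1 h0)

theorem eq_zero_of_evalAt_eq_zero [Finite F] (ht : ∀ i, Squarefree (t i)) {a : Alphabet t}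
    (h : ∀ S : classes t, evalAt (rep S) (rep_mem S) a = 0) : a = 0 := by
  by_contra ha
  obtain ⟨g, hg⟩ := exists_algHom_ne_zero ht ha
  obtain ⟨S, j, hS⟩ := exists_class_of_algHom g
  refine hg ?_
  rw [hS, h S, ZeroMemClass.coe_zero, zero_pow (pow_pos Nat.card_pos j).ne']

/-- The inclusion of kernels induces an embedding of `F(v)` into the closure taking `v` to `w`. As
`F(v)` is finite and normal, this restricts to an automorphism, hence to a Frobenius power. -/
theorem mem_frobClass_of_ker_le [Finite F] {v w : Fin l → AlgebraicClosure F}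
    (hv : v ∈ rootTuples t) (hw : w ∈ rootTuples t)
    (h : RingHom.ker (evalAt v hv) ≤ RingHom.ker (evalAt w hw)) : w ∈ frobClass (F := F) v := by
  have := Fintype.ofFinite F
  have hfin : Finite (residueField v) := Module.finite_of_finite F
  let f : residueField v →ₐ[F] AlgebraicClosure F :=
    AlgHom.liftOfSurjective (evalAt v hv) (evalAt_surjective v hv)
      ((residueField w).val.comp (evalAt w hw)) (fun a ha => by
        have := h ha
        simpa [RingHom.mem_ker] using this)
  have hf (a) : f (evalAt v hv a) = evalAt w hw a :=
    AlgHom.liftOfSurjective_apply ..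
  obtain ⟨j, hj⟩ := (FiniteField.bijective_frobeniusAlgHom_pow F (residueField v)).2
    (f.restrictNormal (residueField v))
  refine ⟨j, funext fun i => ?_⟩
  have h1 := f.restrictNormal_commutes (residueField v)
    (evalAt v hv (Ideal.Quotient.mk _ (MvPolynomial.X i)))
  rw [← hj] at h1
  simp only [AlgHom.coe_pow, FiniteField.coe_frobeniusAlgHom, pow_iterate] at h1
  have h2 : f (evalAt v hv (Ideal.Quotient.mk _ (MvPolynomial.X i))) = w i := by
    rw [hf, evalAt_mk_X]
  rw [Algebra.algebraMap_self, RingHom.id_apply, h2, ← Nat.card_eq_fintype_card, map_pow] at h1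
  rw [← h1]
  exact (congrArg (· ^ (Nat.card F ^ (j : ℕ))) (evalAt_mk_X v hv i)).symm

/-- Chinese remainder theorem: different classes have different, hence comaximal, evaluation
kernels. -/
theorem exists_evalAt_eq [Finite F] (ht : ∀ i, Squarefree (t i))
    (x : ∀ S : classes t, residueField (rep S)) :
    ∃ a : Alphabet t, ∀ S, evalAt (rep S) (rep_mem S) a = x S := by
  have : Finite (classes t) := classes_finite t fun i => (ht i).ne_zero
  let I : classes t → Ideal (Alphabet t) := fun S => RingHom.ker (evalAt (rep S) (rep_mem S))
  have hmax (S) : (I S).IsMaximal := RingHom.ker_isMaximal_of_surjective _ (evalAt_surjective _ _)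
  have hI : Pairwise (Function.onFun IsCoprime I) := fun S S' hne => by
    refine Ideal.isCoprime_of_isMaximal fun h => hne (Subtype.ext ?_)
    rw [← frobClass_rep S, ← frobClass_rep S']
    exact Set.Subset.antisymm
      (frobClass_subset_of_mem (mem_frobClass_of_ker_le _ (rep_mem S) h.ge))
      (frobClass_subset_of_mem (mem_frobClass_of_ker_le _ (rep_mem S') h.le))
  choose y hy using fun S => evalAt_surjective _ (rep_mem S) (x S)
  obtain ⟨a, ha⟩ := Ideal.exists_forall_sub_mem_ideal hI y
  refine ⟨a, fun S => ?_⟩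
  rw [← hy S, ← sub_eq_zero, ← map_sub]
  exact ha S

/-- Idempotents take only the values `0` and `1` in a field. -/
theorem evalAt_mem_range_of_mem_span {v : Fin l → AlgebraicClosure F} (hv : v ∈ rootTuples t)
    {a : Alphabet t} (ha : a ∈ Submodule.span F {ε : Alphabet t | IsPrimitiveIdempotent ε}) :
    ∃ c : F, evalAt v hv a = algebraMap F _ c := by
  induction ha using Submodule.span_induction with
  | mem ε hε =>
    rcases IsIdempotentElem.iff_eq_zero_or_one.1 (hε.1.map (evalAt v hv)) with h | h
    · exact ⟨0, by simp [h]⟩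
    · exact ⟨1, by simp [h]⟩
  | zero => exact ⟨0, by simp⟩
  | add a b _ _ ha hb =>
    obtain ⟨c, hc⟩ := ha
    obtain ⟨d, hd⟩ := hb
    exact ⟨c + d, by simp [hc, hd]⟩
  | smul r a _ ha =>
    obtain ⟨c, hc⟩ := ha
    exact ⟨r * c, by rw [map_smul, hc, Algebra.smul_def, map_mul]⟩

end Alphabet

/-! ### Components of codes, gluing, and `q`-dimensions of hulls. -/

section Codes

variable {F : Type*} [Field F] {l : ℕ} {t : Fin l → F[X]} {n : ℕ}

theorem mem_component {C : Submodule (Alphabet t) (Fin n → Alphabet t)} {S : classes t}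
    {w : Fin n → residueField (rep S)} :
    w ∈ component C S ↔ ∃ c ∈ C, (fun i => evalAt (rep S) (rep_mem S) (c i)) = w := by
  refine ⟨fun h => ?_, fun ⟨c, hc, h⟩ => Submodule.subset_span ⟨c, hc, h⟩⟩
  induction h using Submodule.span_induction with
  | mem w hw => exact hw
  | zero => exact ⟨0, C.zero_mem, by ext; simp⟩
  | add v w _ _ hv hw =>
    obtain ⟨a, ha, rfl⟩ := hv
    obtain ⟨b, hb, rfl⟩ := hw
    exact ⟨a + b, C.add_mem ha hb, by ext; simp⟩
  | smul r w _ hw =>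
    obtain ⟨a, ha, rfl⟩ := hw
    obtain ⟨s, rfl⟩ := evalAt_surjective _ (rep_mem S) r
    exact ⟨s • a, C.smul_mem s ha, by ext; simp⟩

theorem exists_mem_evalAt_eq [Finite F] (ht : ∀ i, Squarefree (t i))
    (C : Submodule (Alphabet t) (Fin n → Alphabet t)) (w : ∀ S : classes t, component C S) :
    ∃ c ∈ C, ∀ S, (fun i => evalAt (rep S) (rep_mem S) (c i)) = w S := by
  classical
  have : Finite (classes t) := classes_finite t fun i => (ht i).ne_zero
  have := Fintype.ofFinite (classes t)
  choose c hc hcw using fun S => mem_component.1 (w S).2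
  -- The `ε S` are the idempotents that cut out the single components.
  choose ε hε using fun S : classes t => exists_evalAt_eq ht (Pi.single S 1)
  refine ⟨∑ S, ε S • c S, C.sum_mem fun S _ => C.smul_mem _ (hc S), fun S => ?_⟩
  rw [← hcw S]
  ext i
  simp only [Finset.sum_apply, Pi.smul_apply, smul_eq_mul, map_sum, map_mul, hε]
  rw [Finset.sum_eq_single S (fun S' _ h => by rw [Pi.single_eq_of_ne h.symm, zero_mul])
    (by simp), Pi.single_eq_same, one_mul]

/-- The code over `𝒜` with prescribed components. -/
def glue (D : ∀ S : classes t, Submodule (residueField (rep S)) (Fin n → residueField (rep S))) :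
    Submodule (Alphabet t) (Fin n → Alphabet t) where
  carrier := {c | ∀ S, (fun i => evalAt (rep S) (rep_mem S) (c i)) ∈ D S}
  add_mem' {a b} ha hb S := by
    convert (D S).add_mem (ha S) (hb S) using 1
    ext; simp
  zero_mem' S := by
    convert (D S).zero_mem using 1
    ext; simp
  smul_mem' r a ha S := by
    convert (D S).smul_mem (evalAt (rep S) (rep_mem S) r) (ha S) using 1
    ext; simp

theorem component_glue [Finite F] (ht : ∀ i, Squarefree (t i))
    (D : ∀ S : classes t, Submodule (residueField (rep S)) (Fin n → residueField (rep S)))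
    (S : classes t) : component (glue D) S = D S := by
  classical
  refine le_antisymm (fun w hw => ?_) fun w hw => ?_
  · obtain ⟨c, hc, rfl⟩ := mem_component.1 hw
    exact hc S
  · choose c hc using fun i => exists_evalAt_eq ht (Pi.single S (w i))
    refine mem_component.2 ⟨c, fun S' => ?_, funext fun i => by rw [hc, Pi.single_eq_same]⟩
    simp only [hc]
    by_cases h : S' = S
    · subst h
      simpa only [Pi.single_eq_same] using hw
    · simp only [Pi.single_eq_of_ne h]
      exact (D S').zero_mem

theorem galoisHull_glue [Finite F] (ht : ∀ i, Squarefree (t i)) (p k : ℕ)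
    (D : ∀ S : classes t, Submodule (residueField (rep S)) (Fin n → residueField (rep S)))
    (hD : ∀ S, ∀ a ∈ D S, ∀ c ∈ D S, ∑ i, a i * c i ^ p ^ k = 0) :
    galoisHull p k (glue D) = glue D := by
  refine inf_eq_left.2 fun a ha c hc => eq_zero_of_evalAt_eq_zero ht fun S => ?_
  simpa only [map_sum, map_mul, map_pow] using hD S _ (ha S) _ (hc S)

theorem isConstacyclic_glue (lam : Alphabet t)
    (D : ∀ S : classes t, Submodule (residueField (rep S)) (Fin (n + 1) → residueField (rep S)))
    (hD : ∀ S, ∀ c ∈ D S, constashift (evalAt (rep S) (rep_mem S) lam) c ∈ D S) :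
    IsConstacyclic lam (glue D) := by
  refine isConstacyclic_of_constashift_mem lam fun c hc S => ?_
  convert hD S _ (hc S) using 1
  ext i
  refine Fin.cases ?_ (fun i => ?_) i <;> simp

theorem finrank_component_galoisHull_le [Finite F] (p k : ℕ) [Fact p.Prime] [CharP F p]
    (C : Submodule (Alphabet t) (Fin n → Alphabet t)) (S : classes t) :
    Module.finrank (residueField (rep S)) (component (galoisHull p k C) S) ≤ n / 2 := by
  have : CharP (residueField (rep S)) p := charP_of_injective_algebraMap' F p
  have hfin : Finite (residueField (rep S)) := Module.finite_of_finite F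
  have hinj : Function.Injective (iterateFrobenius (residueField (rep S)) p k) :=
    RingHom.injective _
  have := two_mul_finrank_le_of_selfOrthogonal (iterateFrobenius (residueField (rep S)) p k)
    (Finite.surjective_of_injective hinj) (component (galoisHull p k C) S)
    (fun a ha c hc => by
      obtain ⟨a, ha', rfl⟩ := mem_component.1 ha
      obtain ⟨c, hc', rfl⟩ := mem_component.1 hc
      have h := congrArg (evalAt (rep S) (rep_mem S)) (ha'.2 c hc'.1)
      simpa only [map_sum, map_mul, map_pow, map_zero, iterateFrobenius_def] using h)
  omega

theorem exists_sum_eq_of_le_card_mul {ι : Type*} [Fintype ι] {h d : ℕ}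
    (hd : d ≤ Fintype.card ι * h) : ∃ f : ι → ℕ, (∀ i, f i ≤ h) ∧ ∑ i, f i = d := by
  classical
  induction d with
  | zero => exact ⟨0, by simp, by simp⟩
  | succ d ih =>
    obtain ⟨f, hf, rfl⟩ := ih (by omega)
    obtain ⟨i, hi⟩ : ∃ i, f i < h := by
      by_contra! hc
      have := Finset.sum_le_sum fun i (_ : i ∈ Finset.univ) => hc i
      simp at this
      omega
    refine ⟨Function.update f i (f i + 1), fun j => ?_, ?_⟩
    · by_cases hj : j = i
      · subst hj; simpa
      · simpa [hj] using hf j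
    · rw [Finset.sum_update_of_mem (Finset.mem_univ i),
        ← Finset.sum_sdiff (Finset.subset_univ {i})]
      simp
      omega

/-- If over every component there are self-orthogonal constacyclic codes of every dimension up to
`n / 2`, then the dimensions of the hulls fill an interval. -/
theorem hullDims_eq_Iic [Finite F] (ht : ∀ i, Squarefree (t i)) (p k : ℕ) [Fact p.Prime]
    [CharP F p] (lam : Alphabet t)
    (H : ∀ S : classes t, ∀ d ≤ (n + 1) / 2,
      ∃ D : Submodule (residueField (rep S)) (Fin (n + 1) → residueField (rep S)),
        (∀ c ∈ D, constashift (evalAt (rep S) (rep_mem S) lam) c ∈ D) ∧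
        (∀ a ∈ D, ∀ c ∈ D, ∑ i, a i * c i ^ p ^ k = 0) ∧
        Module.finrank (residueField (rep S)) D = d) :
    hullDims t p k (n + 1) lam = Set.Iic (numClasses t * ((n + 1) / 2)) := by
  have : Finite (classes t) := classes_finite t fun i => (ht i).ne_zero
  have := Fintype.ofFinite (classes t)
  have hcard : numClasses t = Fintype.card (classes t) := by
    rw [numClasses, ← Nat.card_coe_set_eq, Nat.card_eq_fintype_card]
  rw [hcard]
  ext d
  constructor
  · rintro ⟨C, -, rfl⟩
    rw [qDim, finsum_eq_sum_of_fintype, Set.mem_Iic, ← smul_eq_mul, ← Finset.card_univ]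
    exact Finset.sum_le_card_nsmul _ _ _ fun S _ => finrank_component_galoisHull_le p k C S
  · intro hd
    obtain ⟨f, hf, rfl⟩ := exists_sum_eq_of_le_card_mul hd
    choose D hD1 hD2 hD3 using fun S => H S (f S) (hf S)
    refine ⟨glue D, isConstacyclic_glue lam D hD1, ?_⟩
    rw [galoisHull_glue ht p k D hD2, qDim, finsum_eq_sum_of_fintype]
    exact Finset.sum_congr rfl fun S _ => by rw [component_glue ht, hD3]

theorem residueField_eq_bot {v : Fin l → AlgebraicClosure F} (hv : v ∈ rootTuples t)
    (ht : ∀ i, t i ≠ 0) (hs : ∀ i, (t i).Splits) : residueField v = ⊥ := by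
  refine IntermediateField.adjoin_eq_bot_iff.2 ?_
  rintro _ ⟨i, rfl⟩
  refine IntermediateField.mem_bot.2 ((hs i).mem_range_of_isRoot (ht i) ?_)
  rw [IsRoot.def, eval_map_algebraMap]
  exact hv i

/-- A code is `F`-isomorphic to the product of its components, and splitting makes every residue
field equal to `F`. -/
theorem qDim_eq_finrank [Finite F] (ht : ∀ i, Squarefree (t i)) (hs : ∀ i, (t i).Splits)
    (C : Submodule (Alphabet t) (Fin n → Alphabet t)) : qDim C = Module.finrank F C := by
  have : Finite (classes t) := classes_finite t fun i => (ht i).ne_zero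
  have := Fintype.ofFinite (classes t)
  have hbot (S : classes t) : Module.finrank F (residueField (rep S)) = 1 :=
    IntermediateField.finrank_eq_one_iff.2
      (residueField_eq_bot (rep_mem S) (fun i => (ht i).ne_zero) hs)
  have hfin (S : classes t) : Module.Finite F (component C S) :=
    Module.Finite.trans (residueField (rep S)) _
  have h1 (S : classes t) : Module.finrank (residueField (rep S)) (component C S) =
      Module.finrank F (component C S) := by
    rw [← Module.finrank_mul_finrank F (residueField (rep S)), hbot S, one_mul]
  let φ : C →ₗ[F] ∀ S : classes t, component C S :=
    { toFun c S := ⟨fun i => evalAt (rep S) (rep_mem S) ((c : Fin n → Alphabet t) i),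
        mem_component.2 ⟨c, c.2, rfl⟩⟩
      map_add' a b := by ext; simp
      map_smul' r a := by ext; simp }
  have hφ : Function.Bijective φ := by
    refine ⟨(injective_iff_map_eq_zero _).2 fun c hc => ?_, fun w => ?_⟩
    · refine Subtype.ext (funext fun i => eq_zero_of_evalAt_eq_zero ht fun S => ?_)
      exact congrFun (congrArg Subtype.val (congrFun hc S)) i
    · obtain ⟨c, hc, h⟩ := exists_mem_evalAt_eq ht C w
      exact ⟨⟨c, hc⟩, funext fun S => Subtype.ext (h S)⟩
  rw [qDim, finsum_eq_sum_of_fintype, (LinearEquiv.ofBijective φ hφ).finrank_eq,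
    Module.finrank_pi_fintype]
  exact Finset.sum_congr rfl fun S _ => h1 S

end Codes

/-! ### Choice of `m` and `j` in the two cases. -/

section Existence

variable {K : Type*} [Field K] (p : ℕ) [Fact p.Prime] [CharP K p]

theorem X_pow_mul_sub_C_pow (m a : ℕ) (mu : K) :
    (X ^ (m * p ^ a) - C (mu ^ p ^ a) : K[X]) = (X ^ m - C mu) ^ p ^ a := by
  rw [sub_pow_char_pow, ← pow_mul, C_pow]

theorem exists_selfOrthogonal_of_pow_eq {n : ℕ} (k m a j : ℕ) (hn : n + 1 = m * p ^ a) (mu : K)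
    (hl : (mu ^ p ^ a) ^ (1 + p ^ k) = 1) (hj : p ^ a ≤ 2 * j)
    (hsp : (X ^ (n + 1) - C (mu ^ p ^ a) : K[X]).Splits) (d : ℕ) (hd : d ≤ n + 1 - m * j) :
    ∃ D : Submodule K (Fin (n + 1) → K), (∀ c ∈ D, constashift (mu ^ p ^ a) c ∈ D) ∧
      (∀ a ∈ D, ∀ c ∈ D, ∑ i, a i * c i ^ p ^ k = 0) ∧ Module.finrank K D = d := by
  -- Injectivity of Frobenius allows a `p^a`-th root of `hl`.
  have hmu : mu * mu ^ p ^ k = 1 := by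
    refine iterateFrobenius_inj K p a ?_
    rw [iterateFrobenius_def, map_one, ← hl, ← pow_succ', ← pow_mul, ← pow_mul, mul_comm,
      add_comm 1]
  have hm : m ≠ 0 := by
    rintro rfl
    simp at hn
  refine exists_selfOrthogonal_constashift (mu ^ p ^ a) mu (iterateFrobenius K p k) ?_ hmu m j hm
    ?_ hsp d hd
  · rw [iterateFrobenius_def, ← hl, pow_add, pow_one]
  · rw [hn, X_pow_mul_sub_C_pow]
    exact pow_dvd_pow _ hj

theorem exists_pow_prime_pow_eq [Finite K] (a : ℕ) (c : K) : ∃ mu : K, mu ^ p ^ a = c :=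
  Finite.surjective_of_injective (iterateFrobenius K p a).injective c

theorem splits_X_pow_sub_C_of_dvd_card_sub_one [Finite K] {r n : ℕ} {c : K} (hc : c ^ r = 1)
    (h : r * n ∣ Nat.card K - 1) : (X ^ n - C c : K[X]).Splits := by
  have hq : 1 < Nat.card K := Finite.one_lt_card
  refine splits_X_pow_nat_card_sub_X.of_dvd
    (FiniteField.X_pow_card_sub_X_ne_zero K hq) ?_
  have h1 : (X ^ n - C c : K[X]) ∣ X ^ (r * n) - 1 := by
    have := sub_dvd_pow_sub_pow (X ^ n : K[X]) (C c) r
    rwa [← C_pow, hc, C_1, ← pow_mul, mul_comm n] at this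
  have h2 : (X ^ (r * n) - 1 : K[X]) ∣ X ^ (Nat.card K - 1) - 1 := by
    obtain ⟨s, hs⟩ := h
    have := sub_dvd_pow_sub_pow (X ^ (r * n) : K[X]) 1 s
    rwa [one_pow, ← pow_mul, ← hs] at this
  refine (h1.trans h2).trans ⟨X, ?_⟩
  rw [sub_mul, one_mul, ← pow_succ, Nat.sub_add_cancel hq.le]

end Existence

theorem exists_selfOrthogonal_odd {F : Type*} [Field F] [Finite F] {K : Type*} [Field K]
    [Algebra F K] (p : ℕ) [Fact p.Prime] [CharP F p]
    {n k a : ℕ} (hp : Odd p) (hn : n + 1 = p ^ a) {c : F} (hc : c ^ (1 + p ^ k) = 1) (d : ℕ)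
    (hd : d ≤ (n + 1) / 2) :
    ∃ D : Submodule K (Fin (n + 1) → K), (∀ w ∈ D, constashift (algebraMap F K c) w ∈ D) ∧
      (∀ a ∈ D, ∀ w ∈ D, ∑ i, a i * w i ^ p ^ k = 0) ∧ Module.finrank K D = d := by
  have : CharP K p := charP_of_injective_algebraMap' F p
  obtain ⟨mu, rfl⟩ := exists_pow_prime_pow_eq p a c
  have ho : Odd (n + 1) := hn ▸ hp.pow
  rw [map_pow]
  -- As `n + 1` is odd, `j = (n + 2) / 2` is its half rounded up, which leaves dimension `n + 1 - j
  -- = (n + 1) / 2`.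
  refine exists_selfOrthogonal_of_pow_eq p k 1 a ((n + 2) / 2) (by rw [hn, one_mul])
    (algebraMap F K mu) ?_ ?_ ?_ d ?_
  · rw [← map_pow, ← map_pow, hc, map_one]
  · omega
  · have h := X_pow_mul_sub_C_pow p 1 a (algebraMap F K mu)
    rw [one_mul, pow_one, ← hn] at h
    rw [← hn, h]
    exact (Splits.X_sub_C _).pow _
  · obtain ⟨b, hb⟩ := ho
    omega

theorem exists_selfOrthogonal_even {F : Type*} [Field F] [Finite F] {K : Type*} [Field K]
    [Algebra F K] [CharP F 2] {n n' k a r : ℕ} (hn : n + 1 = n' * 2 ^ (a + 1)) {c : F}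
    (hc : c ^ (1 + 2 ^ k) = 1) (hr : c ^ r = 1) (hrn : r * n' ∣ Nat.card F - 1) (d : ℕ)
    (hd : d ≤ (n + 1) / 2) :
    ∃ D : Submodule K (Fin (n + 1) → K), (∀ w ∈ D, constashift (algebraMap F K c) w ∈ D) ∧
      (∀ a ∈ D, ∀ w ∈ D, ∑ i, a i * w i ^ 2 ^ k = 0) ∧ Module.finrank K D = d := by
  have : CharP K 2 := charP_of_injective_algebraMap' F 2
  -- The polynomial is a `2^(a+1)`-th power of `X^n' - x` with `x^r = 1`, and this divides `X^(r n')
  -- - 1`, hence `X^(q-1) - 1`.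
  have hsp : (X ^ (n + 1) - C c : F[X]).Splits := by
    obtain ⟨x, rfl⟩ := exists_pow_prime_pow_eq 2 (a + 1) c
    rw [hn, X_pow_mul_sub_C_pow]
    refine (splits_X_pow_sub_C_of_dvd_card_sub_one (r := r) ?_ hrn).pow _
    refine iterateFrobenius_inj F 2 (a + 1) ?_
    rw [iterateFrobenius_def, map_one, ← hr, pow_right_comm]
  obtain ⟨mu, rfl⟩ := exists_pow_prime_pow_eq 2 1 c
  have hsp' := hsp.map (algebraMap F K)
  rw [map_pow]
  -- A single square root suffices: `x^(n+1) - mu²` is the square of `x^m - mu` with `m` half the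
  -- length, so `j = 1`.
  refine exists_selfOrthogonal_of_pow_eq 2 k (n' * 2 ^ a) 1 1 (by rw [hn]; ring)
    (algebraMap F K mu) ?_ le_rfl ?_ d ?_
  · rw [← map_pow, ← map_pow, hc, map_one]
  · simpa using hsp'
  · rw [pow_succ, ← mul_assoc] at hn
    omega

theorem exists_evalAt_unit_eq {F : Type*} [Field F] [Finite F] {p e l : ℕ} {t : Fin l → F[X]}
    (hF : Nat.card F = p ^ e) {lam : (Alphabet t)ˣ}
    (hlam : (lam : Alphabet t) ∈ Submodule.span F {ε : Alphabet t | IsPrimitiveIdempotent ε})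
    {k : ℕ} (hk : k < e) (hord : orderOf lam ∣ 1 + p ^ (e - k)) (S : classes t) :
    ∃ c : F, evalAt (rep S) (rep_mem S) lam = algebraMap F _ c ∧ c ^ orderOf lam = 1 ∧
      c ^ (1 + p ^ k) = 1 := by
  obtain ⟨c, hc⟩ := evalAt_mem_range_of_mem_span (rep_mem S) hlam
  have h1 : c ^ orderOf lam = 1 := by
    refine (algebraMap F (residueField (rep S))).injective ?_
    rw [map_pow, ← hc, ← map_pow, ← Units.val_pow_eq_pow_val, pow_orderOf_eq_one, Units.val_one,
      map_one, map_one]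
  refine ⟨c, hc, h1, ?_⟩
  obtain ⟨s, hs⟩ := hord
  have h2 : c ^ (1 + p ^ (e - k)) = 1 := by rw [hs, pow_mul, h1, one_pow]
  have h3 : c ^ p ^ e = c := by
    have := Fintype.ofFinite F
    rw [← hF, Nat.card_eq_fintype_card, FiniteField.pow_card]
  -- Raising to the `p^k`-th power turns the exponent `1 + p^(e-k)` into `p^k + p^e`, and `c^(p^e) =
  -- c`.
  have h4 := congrArg (· ^ p ^ k) h2
  simp only [one_pow, ← pow_mul, add_mul, one_mul, ← pow_add, Nat.sub_add_cancel hk.le] at h4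
  rwa [pow_add, h3, mul_comm, ← pow_succ', add_comm] at h4

end GaloisHull

end

theorem mainTheorem5 {F : Type*} [Field F] [Finite F] (p e : ℕ) (hp : p.Prime)
    (hF : Nat.card F = p ^ e) (l : ℕ) (t : Fin l → Polynomial F) (ht : ∀ i, Squarefree (t i))
    (n n' e' : ℕ) (hn : n = n' * p ^ e') (hn' : Nat.gcd n' p = 1)
    (lam : (GaloisHull.Alphabet t)ˣ)
    (hlam : (lam : GaloisHull.Alphabet t) ∈ Submodule.span F
      {ε : GaloisHull.Alphabet t | GaloisHull.IsPrimitiveIdempotent ε})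
    (hgcd : Nat.gcd (orderOf lam) n' = 1)
    (k : ℕ) (hk : k < e) (hord : orderOf lam ∣ 1 + p ^ (e - k)) :
    (Odd p → n' = 1 →
      ((GaloisHull.hullDims t p k n (lam : GaloisHull.Alphabet t)).ncard : ℚ) =
        (GaloisHull.numClasses t : ℚ) * ((n : ℚ) - 1) / 2 + 1) ∧
    (p = 2 → Even e → k = e / 2 → 1 ≤ e' → orderOf lam * n' ∣ 2 ^ e - 1 →
      ((GaloisHull.hullDims t p k n (lam : GaloisHull.Alphabet t)).ncard : ℚ) =
        (GaloisHull.numClasses t : ℚ) * (n : ℚ) / 2 + 1) ∧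
    ((∀ i, (t i).Splits) →
      ∀ C : Submodule (GaloisHull.Alphabet t) (Fin n → GaloisHull.Alphabet t),
        GaloisHull.qDim C = Module.finrank F C) := by
  have : Fact p.Prime := ⟨hp⟩
  have := Fintype.ofFinite F
  have : CharP F p := charP_of_card_eq_prime_pow (by rw [← Nat.card_eq_fintype_card, hF])
  have hn0 : n ≠ 0 := by
    rintro rfl
    rcases mul_eq_zero.1 hn.symm with rfl | h
    · exact hp.ne_one (by simpa using hn')
    · exact hp.ne_zero (eq_zero_of_pow_eq_zero h)
  obtain ⟨n, rfl⟩ := Nat.exists_eq_add_one_of_ne_zero hn0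
  have hc := GaloisHull.exists_evalAt_unit_eq hF hlam hk hord
  refine ⟨fun hodd hn1 => ?_, fun h2 _ _ he' hdvd => ?_, GaloisHull.qDim_eq_finrank ht⟩
  · subst hn1
    rw [one_mul] at hn
    rw [GaloisHull.hullDims_eq_Iic ht p k _ fun S d hd => ?_, Set.ncard_Iic_nat]
    · obtain ⟨b, hb⟩ : Odd (n + 1) := hn ▸ hodd.pow
      rw [show (n + 1) / 2 = b by omega, hb]
      push_cast
      ring
    · obtain ⟨c, h1, -, h3⟩ := hc S
      rw [h1]
      exact GaloisHull.exists_selfOrthogonal_odd p hodd hn h3 d hd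
  · subst h2
    obtain ⟨a, rfl⟩ := Nat.exists_eq_add_of_le' he'
    rw [GaloisHull.hullDims_eq_Iic ht 2 k _ fun S d hd => ?_, Set.ncard_Iic_nat]
    · have hb : n + 1 = 2 * (n' * 2 ^ a) := by rw [hn]; ring
      rw [hb, Nat.mul_div_cancel_left _ two_pos]
      push_cast
      ring
    · obtain ⟨c, h1, h2, h3⟩ := hc S
      rw [h1]
      exact GaloisHull.exists_selfOrthogonal_even hn h3 h2 (by rwa [hF]) d hd
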